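/- Let $K,c>0$ and let $\mathcal H=\mathbb C\times L^2(0,1)$ (complex-valued functions) with norm $\|(\vartheta,w)\|^2=|\vartheta|^2+\int_0^1|w(x)|^2\,dx$. Let $\mathcal A_w$ be the unbounded operator on $\mathcal H$ given by $$\mathcal A_w(\vartheta,w)=\big(-K\vartheta+w(0),\,-iw''-cw\big),\qquad D(\mathcal A_w)=\{(\vartheta,w)\in\mathbb C\times H^2(0,1):\ w(1)=0,\ w'(0)=0\}.$$ Then $\mathcal A_w:D(\mathcal A_w)\to\mathcal H$ is bijective, and its inverse $\mathcal A_w^{-1}$ is a compact operator on $\mathcal H$. The spectrum of $\mathcal A_w$ consists only of isolated eigenvalues of finite algebraic multiplicity (the dimension of the root subspace $\bigcup_n\ker(\mathcal A_w-\lambda)^n$), and it is exactly the set $$\sigma(\mathcal A_w)=\{-K\}\cup\{\lambda_m:\ m=0,1,2,\dots\},\qquad \lambda_m=-c+i\big(m+\tfrac12\big)^2\pi^2 .$$ The eigenfunctions for the eigenvalue $-K$ are exactly the vectors $(\vartheta_0,0)$ with $\vartheta_0\in\mathbb C\setminus\{0\}$. For every $m\ge 0$ one has $K+\lambda_m\ne0$,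 and the eigenfunctions for $\lambda_m$ are exactly the nonzero scalar multiples of $\big(\tfrac1{K+\lambda_m},\,\cos((m+\tfrac12)\pi x)\big)$. -/

import Mathlib

open MeasureTheory Set
open scoped ContDiff

noncomputable section

namespace SchrodingerCascade

/-! ### Unbounded operators on a complex normed space -/

section Unbounded

variable {E : Type*} [NormedAddCommGroup E] [NormedSpace ℂ E]

/-- The operator `A - z`, with the same domain as `A`. -/
def shift (A : E →ₗ.[ℂ] E) (z : ℂ) : E →ₗ.[ℂ] E where
  domain := A.domain
  toFun := A.toFun - z • A.domain.subtype

/-- `R` is a bounded, everywhere defined, two-sided inverse of the unbounded operator `A`: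
`R` maps into the domain of `A`, `A (R y) = y` for every `y`, and `R (A x) = x` for every `x` in
the domain of `A`. -/
def IsBoundedInverse (A : E →ₗ.[ℂ] E) (R : E →L[ℂ] E) : Prop :=
  (∀ y : E, ∃ h : R y ∈ A.domain, A ⟨R y, h⟩ = y) ∧ ∀ x : A.domain, R (A x) = x

/-- The resolvent set: all `z` for which `A - z` has a bounded everywhere defined inverse. -/
def resolventSet (A : E →ₗ.[ℂ] E) : Set ℂ :=
  {z | ∃ R : E →L[ℂ] E, IsBoundedInverse (shift A z) R}

/-- The spectrum of an unbounded operator: the complement of its resolvent set. -/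
def opSpectrum (A : E →ₗ.[ℂ] E) : Set ℂ := (resolventSet A)ᶜ

/-- `x` is an eigenvector (eigenfunction) of `A` for the eigenvalue `z`. -/
def IsEigenvector (A : E →ₗ.[ℂ] E) (z : ℂ) (x : E) : Prop :=
  x ≠ 0 ∧ ∃ h : x ∈ A.domain, A ⟨x, h⟩ = z • x

/-- `z` is an eigenvalue of `A`. -/
def IsEigenvalue (A : E →ₗ.[ℂ] E) (z : ℂ) : Prop := ∃ x, IsEigenvector A z x

/-- The kernel of `(A - z) ^ n`, taken on the domain of the `n`-th power. -/
def powKer (A : E →ₗ.[ℂ] E) (z : ℂ) : ℕ → Submodule ℂ E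
  | 0 => ⊥
  | n + 1 => ((powKer A z n).comap (shift A z).toFun).map (shift A z).domain.subtype

/-- The root subspace (generalized eigenspace) `⋃ n, ker (A - z) ^ n`; its dimension is the
algebraic multiplicity of `z`. The kernels increase with `n`, so the supremum is their union. -/
def rootSpace (A : E →ₗ.[ℂ] E) (z : ℂ) : Submodule ℂ E := ⨆ n, powKer A z n

/-- `z` is an isolated point of the set `S`. -/
def IsIsolatedIn (S : Set ℂ) (z : ℂ) : Prop :=
  z ∈ S ∧ ∃ ε > 0, ∀ y ∈ S, dist y z < ε → y = z

end Unbounded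

/-! ### The space `L²(0,1)`, weak derivatives and boundary values -/

/-- The complex Hilbert space `L²(0,1)`. -/
abbrev L2 : Type := Lp ℂ 2 (volume.restrict (Ioo (0 : ℝ) 1))

/-- `v ∈ L²(0,1)` is the weak derivative of `u ∈ L²(0,1)`. -/
def IsWeakDeriv (u v : L2) : Prop :=
  ∀ φ : ℝ → ℝ, ContDiff ℝ ∞ φ → HasCompactSupport φ → tsupport φ ⊆ Ioo 0 1 →
    ∫ x in Ioo (0 : ℝ) 1, deriv φ x • u x = -∫ x in Ioo (0 : ℝ) 1, φ x • v x

/-- `u` has a representative that is continuous on `[0,1]` and takes the value `a` at `x`.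
For `u ∈ H¹(0,1)` a continuous representative on `[0,1]` always exists, so that this says
`u(x) = a` in the usual sense of boundary values of Sobolev functions. -/
def HasValueAt (u : L2) (x : ℝ) (a : ℂ) : Prop :=
  ∃ g : ℝ → ℂ, ContinuousOn g (Icc 0 1) ∧ u =ᵐ[volume.restrict (Ioo (0 : ℝ) 1)] g ∧ g x = a

theorem integrable_smul (φ : ℝ → ℝ) (h1 : Continuous φ) (h2 : HasCompactSupport φ) (u : L2) :
    Integrable (fun x => φ x • u x) (volume.restrict (Ioo (0 : ℝ) 1)) := by
  have hu : Integrable (fun x => u x) (volume.restrict (Ioo (0 : ℝ) 1)) :=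
    (Lp.memLp u).integrable (by norm_num)
  obtain ⟨C, hC⟩ := h1.bounded_above_of_compact_support h2
  exact hu.bdd_smul C h1.aestronglyMeasurable (Filter.Eventually.of_forall hC)

theorem IsWeakDeriv.add {u v u' v' : L2} (h : IsWeakDeriv u v) (h' : IsWeakDeriv u' v') :
    IsWeakDeriv (u + u') (v + v') := by
  intro φ h1 h2 h3
  have e : ∀ (ψ : ℝ → ℝ), Continuous ψ → HasCompactSupport ψ → ∀ a b : L2,
      ∫ x in Ioo (0 : ℝ) 1, ψ x • (a + b : L2) x =
        (∫ x in Ioo (0 : ℝ) 1, ψ x • a x) + ∫ x in Ioo (0 : ℝ) 1, ψ x • b x := by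
    intro ψ k1 k2 a b
    rw [← integral_add (integrable_smul ψ k1 k2 a) (integrable_smul ψ k1 k2 b)]
    apply integral_congr_ae
    filter_upwards [Lp.coeFn_add a b] with x hx
    rw [hx, Pi.add_apply, smul_add]
  rw [e _ (h1.continuous_deriv (by simp)) h2.deriv, e _ h1.continuous h2,
    h φ h1 h2 h3, h' φ h1 h2 h3, neg_add]

theorem IsWeakDeriv.smul {u v : L2} (c : ℂ) (h : IsWeakDeriv u v) :
    IsWeakDeriv (c • u) (c • v) := by
  intro φ h1 h2 h3
  have e : ∀ (ψ : ℝ → ℝ) (a : L2), ∫ x in Ioo (0 : ℝ) 1, ψ x • (c • a : L2) x =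
      c • ∫ x in Ioo (0 : ℝ) 1, ψ x • a x := by
    intro ψ a
    rw [← integral_smul]
    apply integral_congr_ae
    filter_upwards [Lp.coeFn_smul c a] with x hx
    rw [hx, Pi.smul_apply, smul_comm]
  rw [e, e, h φ h1 h2 h3, smul_neg]

theorem IsWeakDeriv.unique {u v v' : L2} (h : IsWeakDeriv u v) (h' : IsWeakDeriv u v') :
    v = v' := by
  have hd : IsWeakDeriv 0 (v - v') := by
    have := h.add (h'.smul (-1))
    simpa [sub_eq_add_neg] using this
  have key := isOpen_Ioo.ae_eq_zero_of_integral_contDiff_smul_eq_zero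
    (μ := volume.restrict (Ioo (0 : ℝ) 1)) (U := Ioo (0 : ℝ) 1) (f := fun x => (v - v' : L2) x)
    (((Lp.memLp (v - v')).integrable (by norm_num)).locallyIntegrable.locallyIntegrableOn _)
    (by
      intro φ h1 h2 h3
      have := hd φ h1 h2 h3
      have z : ∫ x in Ioo (0 : ℝ) 1, deriv φ x • (0 : L2) x = 0 := by
        rw [← integral_zero ℝ ℂ (μ := volume.restrict (Ioo (0 : ℝ) 1))]
        apply integral_congr_ae
        filter_upwards [Lp.coeFn_zero ℂ 2 (volume.restrict (Ioo (0 : ℝ) 1))] with x hx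
        rw [hx, Pi.zero_apply, smul_zero]
      rw [z] at this
      exact neg_eq_zero.mp this.symm)
  have : v - v' = 0 := by
    rw [Lp.eq_zero_iff_ae_eq_zero]
    filter_upwards [key, ae_restrict_mem measurableSet_Ioo] with x hx hm using hx hm
  exact sub_eq_zero.mp this

theorem HasValueAt.add {u v : L2} {x : ℝ} {a b : ℂ} (h : HasValueAt u x a)
    (h' : HasValueAt v x b) : HasValueAt (u + v) x (a + b) := by
  obtain ⟨f, f1, f2, rfl⟩ := h
  obtain ⟨g, g1, g2, rfl⟩ := h'
  exact ⟨f + g, f1.add g1, (Lp.coeFn_add u v).trans (f2.add g2), rfl⟩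

theorem HasValueAt.smul {u : L2} {x : ℝ} {a : ℂ} (c : ℂ) (h : HasValueAt u x a) :
    HasValueAt (c • u) x (c • a) := by
  obtain ⟨f, f1, f2, rfl⟩ := h
  exact ⟨c • f, f1.const_smul c, (Lp.coeFn_smul c u).trans (f2.const_smul c), rfl⟩

theorem HasValueAt.zero (x : ℝ) : HasValueAt 0 x 0 :=
  ⟨0, continuousOn_const, Lp.coeFn_zero _ _ _, rfl⟩

theorem IsWeakDeriv.zero : IsWeakDeriv 0 0 := by
  intro φ _ _ _
  have e : ∀ ψ : ℝ → ℝ, ∫ x in Ioo (0 : ℝ) 1, ψ x • (0 : L2) x = 0 := by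
    intro ψ
    rw [← integral_zero ℝ ℂ (μ := volume.restrict (Ioo (0 : ℝ) 1))]
    apply integral_congr_ae
    filter_upwards [Lp.coeFn_zero ℂ 2 (volume.restrict (Ioo (0 : ℝ) 1))] with x hx
    rw [hx, Pi.zero_apply, smul_zero]
  rw [e, e, neg_zero]

theorem HasValueAt.unique {u : L2} {x : ℝ} (hx : x ∈ Icc (0 : ℝ) 1) {a b : ℂ}
    (h : HasValueAt u x a) (h' : HasValueAt u x b) : a = b := by
  obtain ⟨f, f1, f2, rfl⟩ := h
  obtain ⟨g, g1, g2, rfl⟩ := h'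
  have e : f =ᵐ[volume.restrict (Icc (0 : ℝ) 1)] g := by
    rw [← restrict_Ioo_eq_restrict_Icc]
    exact f2.symm.trans g2
  exact Measure.eqOn_Icc_of_ae_eq volume zero_ne_one e f1 g1 hx

open Classical in
/-- The weak derivative `u'` of `u` (zero if `u` has none in `L²(0,1)`). -/
def weakDeriv (u : L2) : L2 := if h : ∃ v, IsWeakDeriv u v then h.choose else 0

open Classical in
/-- The value at `x ∈ [0,1]` of the continuous representative of `u` (zero if there is none). -/
def valueAt (u : L2) (x : ℝ) : ℂ := if h : ∃ a, HasValueAt u x a then h.choose else 0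

theorem IsWeakDeriv.weakDeriv_eq {u v : L2} (h : IsWeakDeriv u v) : weakDeriv u = v := by
  have h' : ∃ v, IsWeakDeriv u v := ⟨v, h⟩
  rw [weakDeriv, dif_pos h']
  exact h'.choose_spec.unique h

theorem HasValueAt.valueAt_eq {u : L2} {x : ℝ} (hx : x ∈ Icc (0 : ℝ) 1) {a : ℂ}
    (h : HasValueAt u x a) : valueAt u x = a := by
  have h' : ∃ a, HasValueAt u x a := ⟨a, h⟩
  rw [valueAt, dif_pos h']
  exact h'.choose_spec.unique hx h

/-- The Sobolev space `H²(0,1)`: the functions in `L²(0,1)` whose first and second weak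
derivatives exist in `L²(0,1)`. -/
def sobolevH2 : Submodule ℂ L2 where
  carrier := {u | ∃ u₁ u₂, IsWeakDeriv u u₁ ∧ IsWeakDeriv u₁ u₂}
  add_mem' := by
    rintro u v ⟨u₁, u₂, h1, h2⟩ ⟨v₁, v₂, k1, k2⟩
    exact ⟨u₁ + v₁, u₂ + v₂, h1.add k1, h2.add k2⟩
  zero_mem' := ⟨0, 0, IsWeakDeriv.zero, IsWeakDeriv.zero⟩
  smul_mem' := by
    rintro c u ⟨u₁, u₂, h1, h2⟩
    exact ⟨c • u₁, c • u₂, h1.smul c, h2.smul c⟩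

theorem isWeakDeriv_weakDeriv {u : L2} (hu : u ∈ sobolevH2) : IsWeakDeriv u (weakDeriv u) := by
  obtain ⟨u₁, u₂, h1, h2⟩ := hu
  rwa [h1.weakDeriv_eq]

theorem isWeakDeriv_weakDeriv₂ {u : L2} (hu : u ∈ sobolevH2) :
    IsWeakDeriv (weakDeriv u) (weakDeriv (weakDeriv u)) := by
  obtain ⟨u₁, u₂, h1, h2⟩ := hu
  rwa [h1.weakDeriv_eq, h2.weakDeriv_eq]

/-! ### The state space and the operator -/

/-- The state space `ℂ × L²(0,1)` with the Hilbert norm `‖(ϑ, w)‖² = |ϑ|² + ∫ |w|²`. -/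
abbrev StateSpace : Type := WithLp 2 (ℂ × L2)

/-- The domain: all `(ϑ, w) ∈ ℂ × H²(0,1)` with `w(1) = 0` and `w'(0) = 0`. -/
def domainAw : Submodule ℂ StateSpace where
  carrier := {Y | Y.snd ∈ sobolevH2 ∧ HasValueAt Y.snd 1 0 ∧ HasValueAt (weakDeriv Y.snd) 0 0}
  add_mem' := by
    rintro Y Z ⟨h1, h2, h3⟩ ⟨k1, k2, k3⟩
    refine ⟨sobolevH2.add_mem h1 k1, ?_, ?_⟩
    · simpa using h2.add k2
    · rw [WithLp.add_snd,
        ((isWeakDeriv_weakDeriv h1).add (isWeakDeriv_weakDeriv k1)).weakDeriv_eq]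
      simpa using h3.add k3
  zero_mem' := by
    refine ⟨sobolevH2.zero_mem, HasValueAt.zero 1, ?_⟩
    rw [WithLp.zero_snd, IsWeakDeriv.zero.weakDeriv_eq]
    exact HasValueAt.zero 0
  smul_mem' := by
    rintro c Y ⟨h1, h2, h3⟩
    refine ⟨sobolevH2.smul_mem c h1, ?_, ?_⟩
    · simpa using h2.smul c
    · rw [WithLp.smul_snd, ((isWeakDeriv_weakDeriv h1).smul c).weakDeriv_eq]
      simpa using h3.smul c

theorem hasValueAt_zero_of_mem {Y : StateSpace} (hY : Y ∈ domainAw) :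
    HasValueAt Y.snd 0 (valueAt Y.snd 0) := by
  obtain ⟨-, ⟨g, g1, g2, -⟩, -⟩ := hY
  have h : HasValueAt Y.snd 0 (g 0) := ⟨g, g1, g2, rfl⟩
  rwa [h.valueAt_eq (by simp)]

/-- The operator `A_w (ϑ, w) = (-K ϑ + w(0), -i w'' - c w)`. -/
def opAw (K c : ℝ) : StateSpace →ₗ.[ℂ] StateSpace where
  domain := domainAw
  toFun :=
    { toFun := fun Y => WithLp.toLp 2
        (-(K : ℂ) * Y.1.fst + valueAt Y.1.snd 0,
          -(Complex.I • weakDeriv (weakDeriv Y.1.snd)) - (c : ℂ) • Y.1.snd)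
      map_add' := by
        rintro ⟨Y, hY⟩ ⟨Z, hZ⟩
        have e1 := ((hasValueAt_zero_of_mem hY).add (hasValueAt_zero_of_mem hZ)).valueAt_eq
          (by simp)
        have e2 := ((isWeakDeriv_weakDeriv hY.1).add (isWeakDeriv_weakDeriv hZ.1)).weakDeriv_eq
        have e3 :=
          ((isWeakDeriv_weakDeriv₂ hY.1).add (isWeakDeriv_weakDeriv₂ hZ.1)).weakDeriv_eq
        rw [← WithLp.toLp_add, Prod.mk_add_mk]
        simp only [Submodule.coe_add, WithLp.add_fst, WithLp.add_snd, e1, e2, e3]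
        congr 2
        · ring
        · simp only [smul_add]
          abel
      map_smul' := by
        rintro a ⟨Y, hY⟩
        have e1 := ((hasValueAt_zero_of_mem hY).smul a).valueAt_eq (by simp)
        have e2 := ((isWeakDeriv_weakDeriv hY.1).smul a).weakDeriv_eq
        have e3 := ((isWeakDeriv_weakDeriv₂ hY.1).smul a).weakDeriv_eq
        rw [RingHom.id_apply, ← WithLp.toLp_smul, Prod.smul_mk]
        simp only [Submodule.coe_smul, WithLp.smul_fst, WithLp.smul_snd, e1, e2, e3]
        congr 2
        · simp only [smul_eq_mul]
          ring
        · rw [smul_sub, smul_neg, smul_comm a Complex.I, smul_comm a (c : ℂ)] }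

/-- `λ_m = -c + i (m + 1/2)² π²`. -/
def eigAw (c : ℝ) (m : ℕ) : ℂ := -(c : ℂ) + Complex.I * ((m : ℂ) + 1 / 2) ^ 2 * (Real.pi : ℂ) ^ 2

theorem memLp_cos (m : ℕ) :
    MemLp (fun x : ℝ => ((Real.cos (((m : ℝ) + 1 / 2) * Real.pi * x) : ℝ) : ℂ)) 2
      (volume.restrict (Ioo (0 : ℝ) 1)) := by
  refine MemLp.of_bound (Continuous.aestronglyMeasurable (by fun_prop)) 1
    (Filter.Eventually.of_forall fun x => ?_)
  rw [Complex.norm_real]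
  exact Real.abs_cos_le_one _

/-- The element `x ↦ cos ((m + 1/2) π x)` of `L²(0,1)`. -/
def cosL2 (m : ℕ) : L2 := (memLp_cos m).toLp _

end SchrodingerCascade

end

noncomputable section

namespace SchrodingerCascade

-- Write `V` for integration from `0` on `L²(0,1)`. Integrating `w'' = g` twice with `w'(0) = w(1) =
-- 0` gives `w = G g`, where `G g = V² g - (V² g)(1)`; `G` is compact because `V` is
-- (Arzelà–Ascoli). A function with vanishing weak derivative is constant, so the domain is exactly
-- the set of pairs `(a, G g)` (`exists_eq_greenOp`). In these coordinates `A - z` is triangular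
-- (`shift_opAw_apply`): its first entry is `-(K + z) a + w(0)`, its second is `-i (1 - q G) g` with
-- `q = i (c + z)`.
--
-- Hence `A - z` is boundedly invertible once `z ≠ -K` and `1 - q G` is invertible. By the Fredholm
-- alternative only `g = q G g` has to be studied. With `q = -κ²` this reads `w'' = -κ² w`, `w'(0) =
-- 0`, so `w = w(0) cos κx`, and `w(1) = 0` forces `w = 0` or `cos κ = 0`. The zeros of the cosine
-- correspond to the `λ_m`.
--
-- For finite multiplicity it is enough that `(A - z) x ∈ span {e}` implies `x ∈ span {e}`, `e`
-- being the eigenvector. At `λ_m` this holds because the resonant equation `w'' = -κ² w + b cos κx`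
-- has a solution with these boundary values only if `b = 0`.

local notation "μ₀" => (volume.restrict (Ioo (0 : ℝ) 1) : Measure ℝ)

open scoped InnerProductSpace

/-! ### Primitives of `L²` functions -/

/-- The indicator function of `(-∞, x]` as an element of `L²(0,1)`. -/
def stepL2 (x : ℝ) : L2 :=
  indicatorConstLp 2 (measurableSet_Iic (a := x)) (measure_ne_top μ₀ _) (1 : ℂ)

/-- The primitive of `f` which vanishes at `0`. -/
def prim (f : L2) (x : ℝ) : ℂ := ⟪stepL2 x, f⟫_ℂ

theorem prim_eq (f : L2) (x : ℝ) : prim f x = ∫ s in Iic x, f s ∂μ₀ :=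
  L2.inner_indicatorConstLp_one _ _ f

theorem prim_add (f g : L2) (x : ℝ) : prim (f + g) x = prim f x + prim g x :=
  inner_add_right _ _ _

theorem prim_smul (a : ℂ) (f : L2) (x : ℝ) : prim (a • f) x = a * prim f x :=
  inner_smul_right _ _ _

/-- The difference is the indicator of `(x, y]`, which has measure at most `y - x`. By
Cauchy–Schwarz, primitives are therefore Hölder continuous with exponent `1/2`, which is the
equicontinuity behind compactness. -/
theorem norm_stepL2_sub_le {x y : ℝ} (h : x ≤ y) : ‖stepL2 y - stepL2 x‖ ≤ √(y - x) := by
  have e : stepL2 y - stepL2 x =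
      indicatorConstLp 2 (measurableSet_Ioc (a := x) (b := y)) (measure_ne_top μ₀ _) (1 : ℂ) := by
    have hu := indicatorConstLp_disjoint_union (p := 2) (measurableSet_Iic (a := x))
      (measurableSet_Ioc (a := x) (b := y)) (measure_ne_top μ₀ _) (measure_ne_top μ₀ _)
      (Set.disjoint_left.2 fun z hz hz' => not_lt.2 hz hz'.1) (1 : ℂ)
    simp only [Iic_union_Ioc_eq_Iic h] at hu
    rw [stepL2, stepL2, hu, add_sub_cancel_left]
  rw [e]
  refine norm_indicatorConstLp_le.trans ?_
  rw [norm_one, one_mul, Real.sqrt_eq_rpow]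
  norm_num
  refine Real.rpow_le_rpow measureReal_nonneg ?_ (by norm_num)
  calc volume.real (Ioc x y ∩ Ioo 0 1) ≤ volume.real (Ioc x y) :=
        measureReal_mono inter_subset_left (by simp)
    _ = y - x := by simp [h]

theorem norm_stepL2_sub_le_abs (x y : ℝ) : ‖stepL2 y - stepL2 x‖ ≤ √|y - x| := by
  rcases le_total x y with h | h
  · rw [abs_of_nonneg (sub_nonneg.2 h)]
    exact norm_stepL2_sub_le h
  · rw [norm_sub_rev, abs_sub_comm, abs_of_nonneg (sub_nonneg.2 h)]
    exact norm_stepL2_sub_le h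

theorem norm_stepL2_le (x : ℝ) : ‖stepL2 x‖ ≤ 1 := by
  refine norm_indicatorConstLp_le.trans ?_
  rw [norm_one, one_mul]
  refine Real.rpow_le_one measureReal_nonneg ?_ (by norm_num)
  calc (μ₀).real (Iic x) ≤ (μ₀).real univ := measureReal_mono (subset_univ _)
    _ = 1 := by simp

theorem continuous_stepL2 : Continuous stepL2 := by
  refine continuous_iff_continuousAt.2 fun x => tendsto_iff_norm_sub_tendsto_zero.2 ?_
  have h : Filter.Tendsto (fun y : ℝ => √|y - x|) (nhds x) (nhds √|x - x|) :=
    Continuous.tendsto (by fun_prop) x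
  rw [sub_self, abs_zero, Real.sqrt_zero] at h
  exact squeeze_zero (fun _ => norm_nonneg _) (fun y => norm_stepL2_sub_le_abs x y) h

theorem continuous_prim (f : L2) : Continuous (prim f) :=
  continuous_stepL2.inner continuous_const

theorem norm_prim_le (f : L2) (x : ℝ) : ‖prim f x‖ ≤ ‖f‖ :=
  (norm_inner_le_norm _ _).trans (mul_le_of_le_one_left (norm_nonneg _) (norm_stepL2_le x))

theorem norm_prim_sub_le (f : L2) (x y : ℝ) : ‖prim f y - prim f x‖ ≤ √|y - x| * ‖f‖ := by
  rw [prim, prim, ← inner_sub_left]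
  exact (norm_inner_le_norm _ _).trans
    (mul_le_mul_of_nonneg_right (norm_stepL2_sub_le_abs x y) (norm_nonneg _))

/-! ### The Volterra operator and its compactness -/

/-- The primitive as a continuous function on `[0,1]`. -/
def primBCF : L2 →L[ℂ] BoundedContinuousFunction (Icc (0 : ℝ) 1) ℂ :=
  LinearMap.mkContinuous
    { toFun := fun f => BoundedContinuousFunction.mkOfCompact
        ⟨fun x => prim f x, (continuous_prim f).comp continuous_subtype_val⟩
      map_add' := fun f g => by
        ext x
        exact prim_add f g x
      map_smul' := fun a f => by
        ext x
        exact prim_smul a f x } 1 fun f => by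
    rw [one_mul]
    exact (BoundedContinuousFunction.norm_le (norm_nonneg _)).2 fun x => norm_prim_le f x

theorem primBCF_apply (f : L2) (x : Icc (0 : ℝ) 1) : primBCF f x = prim f x := rfl

/-- The extension of continuous functions on `[0,1]` to `ℝ`, constant outside of `[0,1]`. -/
def extendBCF :
    BoundedContinuousFunction (Icc (0 : ℝ) 1) ℂ →L[ℂ] BoundedContinuousFunction ℝ ℂ :=
  LinearMap.mkContinuous
    { toFun := fun g => g.compContinuous ⟨projIcc 0 1 zero_le_one, continuous_projIcc⟩
      map_add' := fun _ _ => by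
        ext
        rfl
      map_smul' := fun _ _ => by
        ext
        rfl } 1 fun g => by
    rw [one_mul]
    exact (BoundedContinuousFunction.norm_le (norm_nonneg _)).2 fun x => g.norm_coe_le_norm _

/-- The inclusion of the continuous functions on `[0,1]` into `L²(0,1)`. -/
def bcfToL2 : BoundedContinuousFunction (Icc (0 : ℝ) 1) ℂ →L[ℂ] L2 :=
  (BoundedContinuousFunction.toLp 2 μ₀ ℂ).comp extendBCF

theorem bcfToL2_ae (g : BoundedContinuousFunction (Icc (0 : ℝ) 1) ℂ) :
    bcfToL2 g =ᵐ[μ₀] fun x => g (projIcc 0 1 zero_le_one x) :=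
  BoundedContinuousFunction.coeFn_toLp (E := ℂ) 2 μ₀ ℂ (extendBCF g)

/-- The Volterra operator `f ↦ ∫₀ˣ f` on `L²(0,1)`. -/
def volterra : L2 →L[ℂ] L2 := bcfToL2.comp primBCF

theorem volterra_ae (f : L2) : volterra f =ᵐ[μ₀] prim f := by
  filter_upwards [bcfToL2_ae (primBCF f), ae_restrict_mem measurableSet_Ioo] with x hx hm
  rw [volterra, ContinuousLinearMap.comp_apply, hx, primBCF_apply,
    projIcc_of_mem _ (Ioo_subset_Icc_self hm)]

theorem hasValueAt_volterra (f : L2) (x : ℝ) : HasValueAt (volterra f) x (prim f x) :=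
  ⟨prim f, (continuous_prim f).continuousOn, volterra_ae f, rfl⟩

/-- Arzelà–Ascoli on the image of the unit ball: its elements are bounded by `1` and share the
modulus of continuity `√r`. -/
theorem isCompactOperator_primBCF : IsCompactOperator primBCF := by
  refine (isCompactOperator_iff_isCompact_closure_image_closedBall
    primBCF.toLinearMap one_pos).2 ?_
  refine BoundedContinuousFunction.arzela_ascoli (Metric.closedBall (0 : ℂ) 1)
    (isCompact_closedBall 0 1) _ ?_ ?_
  · rintro _ x ⟨f, hf, rfl⟩
    rw [mem_closedBall_zero_iff] at hf ⊢
    exact (norm_prim_le f x).trans hf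
  · refine Metric.equicontinuous_of_continuity_modulus (fun r => √r) ?_ _ ?_
    · have h : Filter.Tendsto (fun r : ℝ => √r) (nhds 0) (nhds √0) :=
        Real.continuous_sqrt.tendsto 0
      rwa [Real.sqrt_zero] at h
    · rintro x y ⟨_, f, hf, rfl⟩
      rw [mem_closedBall_zero_iff] at hf
      change dist (prim f x) (prim f y) ≤ _
      rw [dist_eq_norm, Subtype.dist_eq, Real.dist_eq]
      exact (norm_prim_sub_le f y x).trans (mul_le_of_le_one_right (Real.sqrt_nonneg _) hf)

theorem isCompactOperator_volterra : IsCompactOperator volterra :=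
  isCompactOperator_primBCF.clm_comp bcfToL2

/-! ### The fundamental theorem of calculus for primitives -/

theorem prim_zero_right (f : L2) : prim f 0 = 0 := by
  have h : Iic (0 : ℝ) ∩ Ioo 0 1 = ∅ := by
    ext x
    simp only [mem_inter_iff, mem_Iic, mem_Ioo, mem_empty_iff_false, iff_false]
    exact fun hx => not_lt.2 hx.1 hx.2.1
  rw [prim_eq, Measure.restrict_restrict measurableSet_Iic, h, setIntegral_empty]

theorem prim_eq_intervalIntegral {f : L2} {h : ℝ → ℂ} (hf : f =ᵐ[μ₀] h) {x : ℝ}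
    (hx : x ∈ Icc (0 : ℝ) 1) : prim f x = ∫ s in (0 : ℝ)..x, h s := by
  rw [prim_eq, intervalIntegral.integral_of_le hx.1, integral_congr_ae (ae_restrict_of_ae hf),
    Measure.restrict_restrict measurableSet_Iic]
  refine setIntegral_congr_set ?_
  refine (ae_eq_refl (Iic x)).inter Ioo_ae_eq_Ioc |>.trans ?_
  rw [inter_comm, Ioc_inter_Iic, min_eq_right hx.2]
  exact ae_eq_refl _

theorem hasDerivAt_prim {f : L2} {h : ℝ → ℂ} (hf : f =ᵐ[μ₀] h) (hc : ContinuousOn h (Icc 0 1))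
    {x : ℝ} (hx : x ∈ Ioo (0 : ℝ) 1) : HasDerivAt (prim f) (h x) x := by
  have h1 : HasDerivAt (fun u => ∫ s in (0 : ℝ)..u, h s) (h x) x := by
    refine intervalIntegral.integral_hasDerivAt_right ?_ ?_ ?_
    · exact (hc.mono (by rw [uIcc_of_le hx.1.le]; exact Icc_subset_Icc_right hx.2.le))
        |>.intervalIntegrable
    · exact (hc.mono Ioo_subset_Icc_self).stronglyMeasurableAtFilter isOpen_Ioo x hx
    · exact hc.continuousAt (Icc_mem_nhds hx.1 hx.2)
  refine h1.congr_of_eventuallyEq ?_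
  filter_upwards [Icc_mem_nhds hx.1 hx.2] with u hu
  exact prim_eq_intervalIntegral hf hu

/-- Exhibits both sides of the weak derivative identity as continuous in the `L²` function, so that
density arguments apply. -/
theorem exists_inner_eq_integral_smul {φ : ℝ → ℝ} (h1 : Continuous φ) (h2 : HasCompactSupport φ) :
    ∃ Φ : L2, ∀ u : L2, ∫ x in Ioo (0 : ℝ) 1, φ x • u x = ⟪Φ, u⟫_ℂ := by
  obtain ⟨C, hC⟩ := h1.bounded_above_of_compact_support h2
  have hm : MemLp (fun x => (φ x : ℂ)) 2 μ₀ :=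
    MemLp.of_bound (Complex.continuous_ofReal.comp h1).aestronglyMeasurable C
      (Filter.Eventually.of_forall fun x => by rw [Complex.norm_real]; exact hC x)
  refine ⟨hm.toLp _, fun u => ?_⟩
  rw [L2.inner_def]
  refine integral_congr_ae ?_
  filter_upwards [hm.coeFn_toLp] with x hx
  rw [hx, RCLike.inner_apply', Complex.conj_ofReal, Complex.real_smul]

/-- Both sides depend continuously on `f`, so bounded continuous `f` suffice. For these it is
integration by parts, the boundary terms vanishing with `φ`. -/
theorem isWeakDeriv_volterra (f : L2) : IsWeakDeriv (volterra f) f := by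
  intro φ h1 h2 h3
  obtain ⟨Φ, hΦ⟩ := exists_inner_eq_integral_smul h1.continuous h2
  obtain ⟨Ψ, hΨ⟩ := exists_inner_eq_integral_smul (h1.continuous_deriv (by simp)) h2.deriv
  refine (BoundedContinuousFunction.toLp_denseRange (E := ℂ) (p := 2) μ₀ ℂ
    (by norm_num)).induction_on f ?_ fun g => ?_
  · simp_rw [hΦ, hΨ]
    exact isClosed_eq (continuous_const.inner volterra.continuous)
      (continuous_const.inner continuous_id).neg
  · set u : L2 := BoundedContinuousFunction.toLp (E := ℂ) 2 μ₀ ℂ g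
    have hu : u =ᵐ[μ₀] g := BoundedContinuousFunction.coeFn_toLp (E := ℂ) 2 μ₀ ℂ g
    have hd : ∀ x, HasDerivAt (fun y => ∫ s in (0 : ℝ)..y, g s) (g x) x := fun x =>
      (g.continuous.integral_hasStrictDerivAt 0 x).hasDerivAt
    have hφ : ∀ x, HasDerivAt φ (deriv φ x) x := fun x =>
      (h1.differentiable (by simp) x).hasDerivAt
    have e1 : ∫ x in Ioo (0 : ℝ) 1, deriv φ x • volterra u x =
        ∫ x in (0 : ℝ)..1, deriv φ x • ∫ s in (0 : ℝ)..x, g s := by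
      rw [intervalIntegral.integral_of_le zero_le_one, ← integral_Ioc_eq_integral_Ioo]
      refine integral_congr_ae ?_
      rw [← restrict_Ioo_eq_restrict_Ioc]
      filter_upwards [volterra_ae u, ae_restrict_mem measurableSet_Ioo] with x hx hm
      rw [hx, prim_eq_intervalIntegral hu (Ioo_subset_Icc_self hm)]
    have e2 : ∫ x in Ioo (0 : ℝ) 1, φ x • u x = ∫ x in (0 : ℝ)..1, φ x • g x := by
      rw [intervalIntegral.integral_of_le zero_le_one, ← integral_Ioc_eq_integral_Ioo]
      refine integral_congr_ae ?_
      rw [← restrict_Ioo_eq_restrict_Ioc]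
      filter_upwards [hu] with x hx
      rw [hx]
    have b0 : φ 0 = 0 := image_eq_zero_of_notMem_tsupport fun h => lt_irrefl _ (h3 h).1
    have b1 : φ 1 = 0 := image_eq_zero_of_notMem_tsupport fun h => lt_irrefl _ (h3 h).2
    rw [e1, e2, intervalIntegral.integral_smul_deriv_eq_deriv_smul
      (fun x _ => hφ x) (fun x _ => hd x)
      ((h1.continuous_deriv (by simp)).intervalIntegrable _ _)
      (g.continuous.intervalIntegrable _ _), b0, b1]
    simp

/-! ### Functions with vanishing weak derivative -/

/-- The constant function `1` in `L²(0,1)`. -/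
def oneL2 : L2 := (memLp_const (1 : ℂ)).toLp _

theorem oneL2_ae : oneL2 =ᵐ[μ₀] fun _ => 1 := (memLp_const (1 : ℂ)).coeFn_toLp

theorem hasValueAt_oneL2 (x : ℝ) : HasValueAt oneL2 x 1 :=
  ⟨fun _ => 1, continuousOn_const, oneL2_ae, rfl⟩

theorem setIntegral_eq_integral_of_tsupport {ψ : ℝ → ℝ} (h : tsupport ψ ⊆ Ioo 0 1) :
    ∫ x in Ioo (0 : ℝ) 1, ψ x = ∫ x, ψ x :=
  setIntegral_eq_integral_of_forall_compl_eq_zero fun _ hx =>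
    image_eq_zero_of_notMem_tsupport fun hx' => hx (h hx')

theorem integral_smul_oneL2 {ψ : ℝ → ℝ} (h : tsupport ψ ⊆ Ioo 0 1) :
    ∫ x in Ioo (0 : ℝ) 1, ψ x • oneL2 x = ((∫ x, ψ x : ℝ) : ℂ) := by
  rw [← setIntegral_eq_integral_of_tsupport h, ← integral_complex_ofReal]
  refine integral_congr_ae ?_
  filter_upwards [oneL2_ae] with x hx
  rw [hx, Complex.real_smul, mul_one]

/-- A test function on `(0,1)` with mean zero is the derivative of a test function. -/
theorem exists_testFunction_deriv_eq {ψ : ℝ → ℝ} (h1 : ContDiff ℝ ∞ ψ) (h2 : HasCompactSupport ψ)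
    (h3 : tsupport ψ ⊆ Ioo 0 1) (h4 : ∫ x, ψ x = 0) :
    ∃ φ : ℝ → ℝ, ContDiff ℝ ∞ φ ∧ HasCompactSupport φ ∧ tsupport φ ⊆ Ioo 0 1 ∧ deriv φ = ψ := by
  have hd : ∀ x, HasDerivAt (fun y => ∫ s in (0 : ℝ)..y, ψ s) (ψ x) x := fun x =>
    (h1.continuous.integral_hasStrictDerivAt 0 x).hasDerivAt
  have hderiv : deriv (fun y => ∫ s in (0 : ℝ)..y, ψ s) = ψ := funext fun x => (hd x).deriv
  -- A compact support keeps a positive distance from the endpoints; for an empty support any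
  -- interval will do.
  obtain ⟨a, b, ha, hb, hab⟩ : ∃ a b : ℝ, 0 < a ∧ b < 1 ∧ tsupport ψ ⊆ Icc a b := by
    rcases (tsupport ψ).eq_empty_or_nonempty with he | hne
    · exact ⟨1 / 2, 1 / 2, by norm_num, by norm_num, by simp [he]⟩
    · have hc : IsCompact (tsupport ψ) := h2
      obtain ⟨a, ha, ha'⟩ := hc.exists_isLeast hne
      obtain ⟨b, hb, hb'⟩ := hc.exists_isGreatest hne
      exact ⟨a, b, (h3 ha).1, (h3 hb).2, fun x hx => ⟨ha' hx, hb' hx⟩⟩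
  have hz : ∀ x, x ∉ Icc a b → ψ x = 0 := fun x hx =>
    image_eq_zero_of_notMem_tsupport fun hx' => hx (hab hx')
  have hz' : ∀ x, x ∉ Icc a b → ∫ s in (0 : ℝ)..x, ψ s = 0 := by
    intro x hx
    rcases lt_or_ge x a with hxa | hxa
    · refine (intervalIntegral.integral_congr (g := fun _ => (0 : ℝ))
        fun s hs => ?_).trans (by simp)
      refine hz s fun hs' => ?_
      have := (max_lt ha hxa).trans_le hs'.1
      exact absurd hs.2 (not_le.2 this)
    · have hxb : b < x := not_le.1 fun h => hx ⟨hxa, h⟩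
      -- Beyond `b` the primitive has collected the whole integral of `ψ`, which is zero.
      rw [intervalIntegral.integral_of_le (ha.le.trans hxa)]
      refine (setIntegral_eq_integral_of_forall_compl_eq_zero
        fun y hy => hz y fun hy' => hy ?_).trans h4
      exact ⟨ha.trans_le hy'.1, hy'.2.trans hxb.le⟩
  have hsupp : tsupport (fun y => ∫ s in (0 : ℝ)..y, ψ s) ⊆ Icc a b := by
    refine closure_minimal (fun x hx => ?_) isClosed_Icc
    by_contra hx'
    exact hx (hz' x hx')
  refine ⟨_, ?_, HasCompactSupport.of_support_subset_isCompact isCompact_Icc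
    (subset_tsupport _ |>.trans hsupp),
    hsupp.trans fun x hx => ⟨ha.trans_le hx.1, hx.2.trans_lt hb⟩, hderiv⟩
  rw [contDiff_infty_iff_deriv, hderiv]
  exact ⟨fun x => (hd x).differentiableAt, h1⟩

/-- An `L²` function whose weak derivative vanishes is constant. -/
theorem IsWeakDeriv.eq_const {u : L2} (hu : IsWeakDeriv u 0) : ∃ C : ℂ, u = C • oneL2 := by
  obtain ⟨ρ, r1, r2, r3, r4⟩ : ∃ ρ : ℝ → ℝ, ContDiff ℝ ∞ ρ ∧ HasCompactSupport ρ ∧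
      tsupport ρ ⊆ Ioo 0 1 ∧ ∫ x, ρ x = 1 := by
    let B : ContDiffBump (1 / 2 : ℝ) := ⟨1 / 8, 1 / 4, by norm_num, by norm_num⟩
    refine ⟨B.normed volume, B.contDiff_normed, B.hasCompactSupport_normed, ?_, B.integral_normed⟩
    rw [B.tsupport_normed_eq, Real.closedBall_eq_Icc]
    exact fun x hx => ⟨lt_of_lt_of_le (by norm_num [B]) hx.1, lt_of_le_of_lt hx.2 (by norm_num [B])⟩
  set C : ℂ := ∫ x in Ioo (0 : ℝ) 1, ρ x • u x
  refine ⟨C, ?_⟩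
  have key := isOpen_Ioo.ae_eq_zero_of_integral_contDiff_smul_eq_zero
    (μ := μ₀) (U := Ioo (0 : ℝ) 1) (f := fun x => (u - C • oneL2 : L2) x)
    (((Lp.memLp (u - C • oneL2)).integrable (by norm_num)).locallyIntegrable.locallyIntegrableOn _)
    (by
      intro ψ h1 h2 h3
      -- Du Bois-Reymond: `ψ - Jρ` has mean zero, hence is the derivative of a test function and
      -- integrates to zero against `u`. So `∫ ψ u = J C = ∫ ψ C`.
      set J : ℝ := ∫ x, ψ x
      have hsub : tsupport (fun x => ψ x - J * ρ x) ⊆ tsupport ψ ∪ tsupport ρ := by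
        refine closure_minimal (fun x hx => ?_) ((isClosed_tsupport ψ).union (isClosed_tsupport ρ))
        by_contra hx'
        rw [mem_union, not_or] at hx'
        refine hx ?_
        simp only [image_eq_zero_of_notMem_tsupport hx'.1, image_eq_zero_of_notMem_tsupport hx'.2,
          mul_zero, sub_zero]
      obtain ⟨φ, p1, p2, p3, p4⟩ := exists_testFunction_deriv_eq
        (ψ := fun x => ψ x - J * ρ x) (h1.sub (contDiff_const.mul r1))
        (HasCompactSupport.of_support_subset_isCompact (h2.isCompact.union r2.isCompact)
          ((subset_tsupport _).trans hsub))
        (hsub.trans (union_subset h3 r3))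
        (by
          rw [integral_sub (h1.continuous.integrable_of_hasCompactSupport h2)
            ((r1.continuous.integrable_of_hasCompactSupport r2).const_mul J), integral_const_mul,
            r4, mul_one, sub_self])
      have h0 := hu φ p1 p2 p3
      have z : ∫ x in Ioo (0 : ℝ) 1, φ x • (0 : L2) x = 0 := by
        rw [← integral_zero ℝ ℂ (μ := μ₀)]
        refine integral_congr_ae ?_
        filter_upwards [Lp.coeFn_zero ℂ 2 μ₀] with x hx
        rw [hx, Pi.zero_apply, smul_zero]
      rw [z, neg_zero, p4] at h0
      have i1 := integrable_smul ψ h1.continuous h2 u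
      have i2 := integrable_smul ρ r1.continuous r2 u
      have i3 := integrable_smul ψ h1.continuous h2 oneL2
      have e1 : ∫ x in Ioo (0 : ℝ) 1, (ψ x - J * ρ x) • u x =
          (∫ x in Ioo (0 : ℝ) 1, ψ x • u x) - J • C := by
        rw [← integral_smul]
        refine Eq.trans ?_ (integral_sub i1 (i2.smul J))
        simp only [sub_smul, mul_smul]
      rw [e1] at h0
      have e2 : ∫ x in Ioo (0 : ℝ) 1, ψ x • (u - C • oneL2 : L2) x =
          (∫ x in Ioo (0 : ℝ) 1, ψ x • u x) - C • (J : ℂ) := by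
        rw [← integral_smul_oneL2 h3, ← integral_smul]
        refine Eq.trans (integral_congr_ae ?_) (integral_sub i1 (i3.smul C))
        filter_upwards [Lp.coeFn_sub u (C • oneL2), Lp.coeFn_smul C oneL2] with x hx hx'
        rw [hx, Pi.sub_apply, hx', Pi.smul_apply, smul_sub, smul_comm]
      rw [e2, ← h0, Complex.real_smul, smul_eq_mul, mul_comm])
  rw [← sub_eq_zero, Lp.eq_zero_iff_ae_eq_zero]
  filter_upwards [key, ae_restrict_mem measurableSet_Ioo] with x hx hm using hx hm

theorem IsWeakDeriv.eq_volterra_add_const {u v : L2} (h : IsWeakDeriv u v) :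
    ∃ C : ℂ, u = volterra v + C • oneL2 := by
  have h0 : IsWeakDeriv (u - volterra v) 0 := by
    have := h.add ((isWeakDeriv_volterra v).smul (-1))
    simpa [sub_eq_add_neg] using this
  obtain ⟨C, hC⟩ := h0.eq_const
  exact ⟨C, by rw [← hC, add_sub_cancel]⟩

theorem isWeakDeriv_oneL2 : IsWeakDeriv oneL2 0 := by
  intro φ h1 h2 h3
  have z : ∫ x in Ioo (0 : ℝ) 1, φ x • (0 : L2) x = 0 := by
    rw [← integral_zero ℝ ℂ (μ := μ₀)]
    refine integral_congr_ae ?_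
    filter_upwards [Lp.coeFn_zero ℂ 2 μ₀] with x hx
    rw [hx, Pi.zero_apply, smul_zero]
  rw [z, integral_smul_oneL2 (tsupport_deriv_subset.trans h3), neg_zero,
    integral_eq_zero_of_hasDerivAt_of_integrable
      (fun x => (h1.differentiable (by simp) x).hasDerivAt)
      ((h1.continuous_deriv (by simp)).integrable_of_hasCompactSupport h2.deriv)
      (h1.continuous.integrable_of_hasCompactSupport h2), Complex.ofReal_zero]

/-! ### The Green operator and the domain of `A_w` -/

/-- The functional `f ↦ ∫₀¹ f`. -/
def meanL2 : L2 →L[ℂ] ℂ := innerSL ℂ (stepL2 1)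

/-- The solution operator `g ↦ w` of the boundary value problem `w'' = g`, `w'(0) = w(1) = 0`. -/
def greenOp : L2 →L[ℂ] L2 :=
  (volterra - meanL2.smulRight oneL2).comp volterra

/-- Integrating twice from `0` secures `w'(0) = 0`; the subtracted constant secures `w(1) = 0`. -/
theorem greenOp_apply (g : L2) :
    greenOp g = volterra (volterra g) + (-prim (volterra g) 1) • oneL2 := by
  rw [neg_smul, ← sub_eq_add_neg]
  rfl

theorem isCompactOperator_greenOp : IsCompactOperator greenOp :=
  isCompactOperator_volterra.clm_comp (volterra - meanL2.smulRight oneL2)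

/-- The functional `g ↦ w(0)`, where `w'' = g`, `w'(0) = w(1) = 0`. -/
def greenZero : L2 →L[ℂ] ℂ := -(meanL2.comp volterra)

theorem greenZero_apply (g : L2) : greenZero g = -prim (volterra g) 1 := rfl

/-- The continuous representative of `greenOp g`. -/
def greenFun (g : L2) (x : ℝ) : ℂ := prim (volterra g) x - prim (volterra g) 1

theorem greenFun_zero (g : L2) : greenFun g 0 = greenZero g := by
  rw [greenFun, prim_zero_right, zero_sub, greenZero_apply]

theorem greenFun_one (g : L2) : greenFun g 1 = 0 := sub_self _

theorem continuous_greenFun (g : L2) : Continuous (greenFun g) :=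
  (continuous_prim _).sub continuous_const

theorem greenOp_ae (g : L2) : greenOp g =ᵐ[μ₀] greenFun g := by
  rw [greenOp_apply]
  filter_upwards [Lp.coeFn_add (volterra (volterra g)) ((-prim (volterra g) 1) • oneL2),
    Lp.coeFn_smul (-prim (volterra g) 1) oneL2, oneL2_ae, volterra_ae (volterra g)]
    with x h1 h2 h3 h4
  rw [h1, Pi.add_apply, h2, Pi.smul_apply, h3, h4, smul_eq_mul, mul_one, greenFun, sub_eq_add_neg]

theorem hasValueAt_greenOp (g : L2) (x : ℝ) : HasValueAt (greenOp g) x (greenFun g x) :=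
  ⟨greenFun g, (continuous_greenFun g).continuousOn, greenOp_ae g, rfl⟩

theorem isWeakDeriv_greenOp (g : L2) : IsWeakDeriv (greenOp g) (volterra g) := by
  rw [greenOp_apply]
  have h := (isWeakDeriv_volterra (volterra g)).add
    (isWeakDeriv_oneL2.smul (-prim (volterra g) 1))
  rwa [smul_zero, add_zero] at h

theorem hasDerivAt_greenFun (g : L2) {x : ℝ} (hx : x ∈ Ioo (0 : ℝ) 1) :
    HasDerivAt (greenFun g) (prim g x) x :=
  (hasDerivAt_prim (volterra_ae g) (continuous_prim g).continuousOn hx).sub_const _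

theorem weakDeriv_greenOp (g : L2) : weakDeriv (greenOp g) = volterra g :=
  (isWeakDeriv_greenOp g).weakDeriv_eq

theorem weakDeriv_volterra (g : L2) : weakDeriv (volterra g) = g :=
  (isWeakDeriv_volterra g).weakDeriv_eq

theorem valueAt_greenOp_zero (g : L2) : valueAt (greenOp g) 0 = greenZero g := by
  rw [(hasValueAt_greenOp g 0).valueAt_eq (by simp), greenFun_zero]

theorem toLp_greenOp_mem (a : ℂ) (g : L2) :
    (WithLp.toLp 2 (a, greenOp g) : StateSpace) ∈ domainAw := by
  refine ⟨⟨_, _, isWeakDeriv_greenOp g, isWeakDeriv_volterra g⟩, ?_, ?_⟩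
  · have h := hasValueAt_greenOp g 1
    rwa [greenFun_one] at h
  · change HasValueAt (weakDeriv (greenOp g)) 0 0
    have h := hasValueAt_volterra g 0
    rwa [prim_zero_right, ← weakDeriv_greenOp] at h

/-- Of the two constants of integration, `w'(0) = 0` kills `C`, and `w(1) = 0` fixes `D` as the
constant in `greenOp`. -/
theorem exists_eq_greenOp {Y : StateSpace} (hY : Y ∈ domainAw) :
    ∃ a g, Y = WithLp.toLp 2 (a, greenOp g) := by
  obtain ⟨⟨u₁, u₂, h1, h2⟩, v1, v0⟩ := hY
  rw [h1.weakDeriv_eq] at v0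
  refine ⟨Y.fst, u₂, ?_⟩
  obtain ⟨C, rfl⟩ := h2.eq_volterra_add_const
  have hC : C = 0 := by
    have h := ((hasValueAt_volterra u₂ 0).add ((hasValueAt_oneL2 0).smul C)).unique (by simp) v0
    simpa [prim_zero_right] using h
  rw [hC, zero_smul, add_zero] at h1
  obtain ⟨D, hD⟩ := h1.eq_volterra_add_const
  rw [hD] at v1
  have h := ((hasValueAt_volterra (volterra u₂) 1).add
    ((hasValueAt_oneL2 1).smul D)).unique (by simp) v1
  rw [smul_eq_mul, mul_one] at h
  have e : Y.snd = greenOp u₂ := by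
    rw [hD, greenOp_apply, eq_neg_of_add_eq_zero_right h]
  rw [← e]
  rfl

/-- The central reduction: all questions about `A - z` become questions about `1 - q G` with `q = i
(c + z)`, together with one scalar equation. -/
theorem shift_opAw_apply (K c : ℝ) (z a : ℂ) (g : L2)
    (h : (WithLp.toLp 2 (a, greenOp g) : StateSpace) ∈ (shift (opAw K c) z).domain) :
    shift (opAw K c) z ⟨WithLp.toLp 2 (a, greenOp g), h⟩ =
      WithLp.toLp 2 (-(K + z) * a + greenZero g,
        -Complex.I • (g - (Complex.I * (c + z)) • greenOp g)) := by
  have e : shift (opAw K c) z ⟨WithLp.toLp 2 (a, greenOp g), h⟩ =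
      WithLp.toLp 2 (-(K : ℂ) * a + valueAt (greenOp g) 0,
          -(Complex.I • weakDeriv (weakDeriv (greenOp g))) - (c : ℂ) • greenOp g) -
        z • (WithLp.toLp 2 (a, greenOp g) : StateSpace) := rfl
  rw [e, weakDeriv_greenOp, weakDeriv_volterra, valueAt_greenOp_zero, ← WithLp.toLp_smul,
    ← WithLp.toLp_sub, Prod.smul_mk, Prod.mk_sub_mk]
  congr 2
  · rw [smul_eq_mul]
    ring
  · rw [smul_sub, smul_smul, ← mul_assoc, neg_mul, Complex.I_mul_I, neg_neg, one_mul, add_smul,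
      neg_smul]
    abel

/-! ### The equation `w'' = -κ² w + b cos κx` -/

theorem eq_of_hasDerivAt_zero {f : ℝ → ℂ} (hc : Continuous f)
    (hd : ∀ x ∈ Ioo (0 : ℝ) 1, HasDerivAt f 0 x) {x : ℝ} (hx : x ∈ Icc (0 : ℝ) 1) :
    f x = f 0 := by
  have h := intervalIntegral.integral_eq_sub_of_hasDerivAt_of_le (f := f) (f' := fun _ => 0) hx.1
    hc.continuousOn (fun y hy => hd y ⟨hy.1, hy.2.trans_le hx.2⟩) (by simp)
  rw [intervalIntegral.integral_zero] at h
  exact (sub_eq_zero.1 h.symm)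

theorem hasDerivAt_cos_mul (κ : ℂ) (x : ℝ) :
    HasDerivAt (fun x : ℝ => Complex.cos (κ * x)) (-(κ * Complex.sin (κ * x))) x := by
  have h : HasDerivAt (fun x : ℝ => κ * (x : ℂ)) κ x := by
    simpa using (Complex.ofRealCLM.hasDerivAt (x := x)).const_mul κ
  refine ((Complex.hasDerivAt_cos (κ * x)).comp x h).congr_deriv ?_
  ring

theorem hasDerivAt_sin_mul (κ : ℂ) (x : ℝ) :
    HasDerivAt (fun x : ℝ => Complex.sin (κ * x)) (κ * Complex.cos (κ * x)) x := by
  have h : HasDerivAt (fun x : ℝ => κ * (x : ℂ)) κ x := by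
    simpa using (Complex.ofRealCLM.hasDerivAt (x := x)).const_mul κ
  refine ((Complex.hasDerivAt_sin (κ * x)).comp x h).congr_deriv ?_
  ring

/-- Solutions of `g = w''`, `w'' = -κ² w + b cos (κ ·)`. -/
theorem hasDerivAt_prim_of_ae {g : L2} {κ b : ℂ}
    (hg : g =ᵐ[μ₀] fun x => -κ ^ 2 * greenFun g x + b * Complex.cos (κ * x)) {x : ℝ}
    (hx : x ∈ Ioo (0 : ℝ) 1) :
    HasDerivAt (prim g) (-κ ^ 2 * greenFun g x + b * Complex.cos (κ * x)) x := by
  refine hasDerivAt_prim hg (Continuous.continuousOn ?_) hx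
  have := continuous_greenFun g
  fun_prop

theorem greenFun_eq_cos {g : L2} {κ : ℂ} (hg : g = (-κ ^ 2) • greenOp g) {x : ℝ}
    (hx : x ∈ Icc (0 : ℝ) 1) : greenFun g x = greenZero g * Complex.cos (κ * x) := by
  have hg' : g =ᵐ[μ₀] fun x => -κ ^ 2 * greenFun g x + 0 * Complex.cos (κ * x) := by
    have h : g =ᵐ[μ₀] ((-κ ^ 2) • greenOp g : L2) := by rw [← hg]
    filter_upwards [h, Lp.coeFn_smul (-κ ^ 2) (greenOp g), greenOp_ae g] with y h1 h2 h3
    rw [h1, h2, Pi.smul_apply, h3, smul_eq_mul, zero_mul, add_zero]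
  have c1 := continuous_greenFun g
  have c2 := continuous_prim g
  rcases eq_or_ne κ 0 with rfl | hκ
  · have hz : g = 0 := by rw [hg, zero_pow two_ne_zero, neg_zero, zero_smul]
    rw [hz, map_zero, zero_mul, greenFun, map_zero, prim, prim, inner_zero_right, inner_zero_right,
      sub_zero]
  -- `A` and `B` say that the vector `(κ w, w')`, rotated through the angle `κx`, is constant.
  -- Rotating back yields `κ w = κ w(0) cos κx`. Division by `κ` is why `κ = 0` was treated apart.
  have A := eq_of_hasDerivAt_zero
    (f := fun x => κ * (greenFun g x * Complex.cos (κ * x)) - prim g x * Complex.sin (κ * x))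
    (by fun_prop) (fun y hy => by
      refine ((((hasDerivAt_greenFun g hy).mul (hasDerivAt_cos_mul κ y)).const_mul κ).sub
        ((hasDerivAt_prim_of_ae hg' hy).mul (hasDerivAt_sin_mul κ y)) |>.congr_deriv ?_)
      ring) hx
  have B := eq_of_hasDerivAt_zero
    (f := fun x => κ * (greenFun g x * Complex.sin (κ * x)) + prim g x * Complex.cos (κ * x))
    (by fun_prop) (fun y hy => by
      refine ((((hasDerivAt_greenFun g hy).mul (hasDerivAt_sin_mul κ y)).const_mul κ).add
        ((hasDerivAt_prim_of_ae hg' hy).mul (hasDerivAt_cos_mul κ y)) |>.congr_deriv ?_)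
      ring) hx
  simp only [Complex.ofReal_zero, mul_zero, Complex.cos_zero, Complex.sin_zero, mul_one, add_zero,
    greenFun_zero, prim_zero_right, sub_zero] at A B
  have hs := Complex.sin_sq_add_cos_sq (κ * x)
  refine mul_left_cancel₀ hκ ?_
  linear_combination Complex.cos (κ * x) * A + Complex.sin (κ * x) * B - κ * greenFun g x * hs

/-- If `κ` is a resonance (`cos κ = 0`), then `w'' = -κ² w + b cos (κ ·)` with `w'(0) = w(1) = 0`
is solvable only for `b = 0`. -/
theorem eq_zero_of_resonance {g : L2} {κ b : ℂ} (hκ : κ ≠ 0) (hcos : Complex.cos κ = 0)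
    (hg : g =ᵐ[μ₀] fun x => -κ ^ 2 * greenFun g x + b * Complex.cos (κ * x)) : b = 0 := by
  have c1 := continuous_greenFun g
  have c2 := continuous_prim g
  -- The derivative of `κ w sin κx + w' cos κx` is `b cos² κx`, and the subtracted term is `b` times
  -- a primitive of `cos² κx`. At `x = 1` only `-b/2` survives; at `x = 0` everything vanishes.
  have A := eq_of_hasDerivAt_zero (x := 1)
    (f := fun x => κ * (greenFun g x * Complex.sin (κ * x)) + prim g x * Complex.cos (κ * x) -
      b * ((1 / 2 : ℂ) * (x : ℂ) + (1 / (2 * κ)) * (Complex.sin (κ * x) * Complex.cos (κ * x))))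
    (by fun_prop) (fun y hy => by
      have hid : HasDerivAt (fun x : ℝ => (x : ℂ)) 1 y := Complex.ofRealCLM.hasDerivAt
      refine (((((hasDerivAt_greenFun g hy).mul (hasDerivAt_sin_mul κ y)).const_mul κ).add
        ((hasDerivAt_prim_of_ae hg hy).mul (hasDerivAt_cos_mul κ y))).sub
        (((hid.const_mul (1 / 2 : ℂ)).add (((hasDerivAt_sin_mul κ y).mul
          (hasDerivAt_cos_mul κ y)).const_mul (1 / (2 * κ)))).const_mul b) |>.congr_deriv ?_)
      have hs := Complex.sin_sq_add_cos_sq (κ * y)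
      field_simp
      linear_combination b * hs) (by simp)
  simp only [Complex.ofReal_zero, Complex.ofReal_one, mul_zero, Complex.sin_zero, mul_one,
    add_zero, greenFun_one, prim_zero_right, hcos, zero_mul, sub_self,
    zero_sub, neg_eq_zero, mul_eq_zero] at A
  simpa using A

/-! ### Eigenvectors and root spaces of unbounded operators -/

section Unbounded

variable {E : Type*} [NormedAddCommGroup E] [NormedSpace ℂ E]

theorem shift_apply (A : E →ₗ.[ℂ] E) (z : ℂ) (x : E) (h : x ∈ A.domain) :
    shift A z ⟨x, h⟩ = A ⟨x, h⟩ - z • x := rfl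

theorem isEigenvector_iff_shift {A : E →ₗ.[ℂ] E} {z : ℂ} {x : E} :
    IsEigenvector A z x ↔ x ≠ 0 ∧ ∃ h : x ∈ (shift A z).domain, shift A z ⟨x, h⟩ = 0 :=
  and_congr_right fun _ => exists_congr fun _ => sub_eq_zero.symm

theorem IsEigenvector.smul {A : E →ₗ.[ℂ] E} {z : ℂ} {x : E} (h : IsEigenvector A z x) {a : ℂ}
    (ha : a ≠ 0) : IsEigenvector A z (a • x) := by
  obtain ⟨h0, hx, e⟩ := h
  refine ⟨smul_ne_zero ha h0, A.domain.smul_mem a hx, ?_⟩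
  rw [smul_comm, ← e]
  exact A.map_smul a ⟨x, hx⟩

theorem IsEigenvalue.mem_opSpectrum {A : E →ₗ.[ℂ] E} {z : ℂ} (h : IsEigenvalue A z) :
    z ∈ opSpectrum A := by
  obtain ⟨x, hx⟩ := h
  obtain ⟨h0, hx, e⟩ := isEigenvector_iff_shift.1 hx
  rintro ⟨R, -, hR⟩
  have := hR ⟨x, hx⟩
  rw [e, map_zero] at this
  exact h0 this.symm

theorem IsBoundedInverse.of_shift_zero {A : E →ₗ.[ℂ] E} {R : E →L[ℂ] E}
    (h : IsBoundedInverse (shift A 0) R) : IsBoundedInverse A R := by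
  have e : ∀ x : A.domain, shift A 0 x = A x := fun x =>
    (shift_apply A 0 x x.2).trans (by rw [zero_smul, sub_zero])
  refine ⟨fun y => ?_, fun x => ?_⟩
  · obtain ⟨hy, h'⟩ := h.1 y
    exact ⟨hy, (e _).symm.trans h'⟩
  · rw [← e]
    exact h.2 x

/-- If `e` spans the preimage of its span under `A - z`, it spans the root space. -/
theorem rootSpace_le_span {A : E →ₗ.[ℂ] E} {z : ℂ} {e : E}
    (H : ∀ x (h : x ∈ (shift A z).domain), shift A z ⟨x, h⟩ ∈ Submodule.span ℂ {e} →
      x ∈ Submodule.span ℂ {e}) : rootSpace A z ≤ Submodule.span ℂ {e} := by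
  refine iSup_le fun n => ?_
  induction n with
  | zero => exact bot_le
  | succ n ih =>
    rintro _ ⟨⟨x, hx⟩, h, rfl⟩
    exact H x hx (ih h)

/-- `A - z` maps an eigenvector to `0`, which lies in the span; so the hypothesis that bounds the
root space also determines the eigenvectors. -/
theorem isEigenvector_iff_smul {A : E →ₗ.[ℂ] E} {z : ℂ} {e : E} (he : IsEigenvector A z e)
    (H : ∀ x (h : x ∈ (shift A z).domain), shift A z ⟨x, h⟩ ∈ Submodule.span ℂ {e} →
      x ∈ Submodule.span ℂ {e}) (x : E) :
    IsEigenvector A z x ↔ ∃ a : ℂ, a ≠ 0 ∧ x = a • e := by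
  constructor
  · intro h
    obtain ⟨h0, hx, h1⟩ := isEigenvector_iff_shift.1 h
    obtain ⟨a, rfl⟩ := Submodule.mem_span_singleton.1 (H x hx (by rw [h1]; exact zero_mem _))
    exact ⟨a, fun ha => h0 (by rw [ha, zero_smul]), rfl⟩
  · rintro ⟨a, ha, rfl⟩
    exact he.smul ha

end Unbounded

/-! ### Resonant frequencies and the Fredholm alternative -/

/-- The frequencies `(m + 1/2) π`. -/
def freq (m : ℕ) : ℂ := ((m : ℂ) + 1 / 2) * (Real.pi : ℂ)

theorem freq_eq_ofReal (m : ℕ) : freq m = (((m : ℝ) + 1 / 2) * Real.pi : ℝ) := by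
  simp [freq]

theorem freq_ne_zero (m : ℕ) : freq m ≠ 0 := by
  rw [freq_eq_ofReal]
  exact Complex.ofReal_ne_zero.2 (by positivity)

theorem cos_freq (m : ℕ) : Complex.cos (freq m) = 0 :=
  Complex.cos_eq_zero_iff.2 ⟨m, by rw [freq]; push_cast; ring⟩

theorem exists_sq_eq_freq_sq {κ : ℂ} (h : Complex.cos κ = 0) : ∃ m : ℕ, κ ^ 2 = freq m ^ 2 := by
  obtain ⟨k, rfl⟩ := Complex.cos_eq_zero_iff.1 h
  obtain ⟨n, rfl | rfl⟩ := k.eq_nat_or_neg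
  · exact ⟨n, by rw [freq]; push_cast; ring⟩
  · cases n with
    | zero => exact ⟨0, by rw [freq]; push_cast; ring⟩
    -- For `k = -(n + 1)` the zero is `-freq n`, which has the same square as `freq n`.
    | succ n => exact ⟨n, by rw [freq]; push_cast; ring⟩

theorem I_mul_add_eigAw (c : ℝ) (m : ℕ) : Complex.I * (c + eigAw c m) = -freq m ^ 2 := by
  rw [eigAw, freq]
  linear_combination ((m : ℂ) + 1 / 2) ^ 2 * (Real.pi : ℂ) ^ 2 * Complex.I_sq

theorem cosL2_ae (m : ℕ) : cosL2 m =ᵐ[μ₀] fun x => Complex.cos (freq m * x) := by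
  filter_upwards [(memLp_cos m).coeFn_toLp] with x hx
  rw [cosL2, hx, freq_eq_ofReal, Complex.ofReal_cos, Complex.ofReal_mul]

theorem hasValueAt_cosL2_zero (m : ℕ) : HasValueAt (cosL2 m) 0 1 :=
  ⟨_, Continuous.continuousOn (by fun_prop), cosL2_ae m, by simp⟩

theorem prim_cosL2 (m : ℕ) {x : ℝ} (hx : x ∈ Icc (0 : ℝ) 1) :
    freq m * prim (cosL2 m) x = Complex.sin (freq m * x) := by
  have c1 := continuous_prim (cosL2 m)
  have h := eq_of_hasDerivAt_zero
    (f := fun x => freq m * prim (cosL2 m) x - Complex.sin (freq m * x)) (by fun_prop)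
    (fun y hy => (((hasDerivAt_prim (cosL2_ae m)
      (Continuous.continuousOn (by fun_prop)) hy).const_mul
      (freq m)).sub (hasDerivAt_sin_mul (freq m) y)).congr_deriv (sub_self _)) hx
  simpa [prim_zero_right, sub_eq_zero] using h

/-- The sum of `freq m ^ 2 * greenFun (cosL2 m)` and the cosine has derivative zero, and both terms
vanish at `1`. -/
theorem greenFun_cosL2 (m : ℕ) {x : ℝ} (hx : x ∈ Icc (0 : ℝ) 1) :
    -freq m ^ 2 * greenFun (cosL2 m) x = Complex.cos (freq m * x) := by
  have c1 := continuous_greenFun (cosL2 m)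
  have h : ∀ x ∈ Icc (0 : ℝ) 1, _ := fun x hx => eq_of_hasDerivAt_zero
    (f := fun x => freq m ^ 2 * greenFun (cosL2 m) x + Complex.cos (freq m * x)) (by fun_prop)
    (fun y hy => (((hasDerivAt_greenFun (cosL2 m) hy).const_mul (freq m ^ 2)).add
      (hasDerivAt_cos_mul (freq m) y)).congr_deriv (by
        rw [← prim_cosL2 m (Ioo_subset_Icc_self hy)]
        ring)) hx
  have h1 := h 1 (by simp)
  rw [greenFun_one, Complex.ofReal_one, mul_one, cos_freq, mul_zero, add_zero] at h1
  have hx' := h x hx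
  rw [← h1] at hx'
  linear_combination -hx'

theorem greenOp_cosL2 (m : ℕ) : (-freq m ^ 2) • greenOp (cosL2 m) = cosL2 m := by
  refine Lp.ext ?_
  filter_upwards [Lp.coeFn_smul (-freq m ^ 2) (greenOp (cosL2 m)), greenOp_ae (cosL2 m), cosL2_ae m,
    ae_restrict_mem measurableSet_Ioo] with x h1 h2 h3 hm
  rw [h1, Pi.smul_apply, h2, h3, smul_eq_mul, greenFun_cosL2 m (Ioo_subset_Icc_self hm)]

theorem cosL2_ne_zero (m : ℕ) : cosL2 m ≠ 0 := fun h => by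
  have h1 := hasValueAt_cosL2_zero m
  rw [h] at h1
  exact one_ne_zero (h1.unique (by simp) (HasValueAt.zero 0))

/-- With a complex root `κ` of `-q`, the solution is `w(0) cos κx`. Since `w(1) = 0`, either `w(0) =
0` or `cos κ = 0`, and the latter makes `q` exceptional. -/
theorem eq_zero_of_eq_smul_greenOp {q : ℂ} (hq : ∀ m, q ≠ -freq m ^ 2) {g : L2}
    (hg : g = q • greenOp g) : g = 0 := by
  obtain ⟨κ, hκ⟩ := IsAlgClosed.exists_pow_nat_eq (-q) two_pos
  obtain rfl : q = -κ ^ 2 := by rw [hκ, neg_neg]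
  have h1 := greenFun_eq_cos hg (x := 1) (by simp)
  rw [greenFun_one, Complex.ofReal_one, mul_one, eq_comm, mul_eq_zero] at h1
  rcases h1 with h1 | h1
  · have h2 : greenOp g = 0 := by
      rw [Lp.eq_zero_iff_ae_eq_zero]
      filter_upwards [greenOp_ae g, ae_restrict_mem measurableSet_Ioo] with x hx hm
      rw [hx, greenFun_eq_cos hg (Ioo_subset_Icc_self hm), h1, zero_mul, Pi.zero_apply]
    rw [hg, h2, smul_zero]
  · obtain ⟨m, hm⟩ := exists_sq_eq_freq_sq h1
    exact absurd (by rw [hm]) (hq m)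

theorem greenOp_eq_smul_cosL2 {m : ℕ} {g : L2} (hg : g = (-freq m ^ 2) • greenOp g) :
    greenOp g = greenZero g • cosL2 m := by
  refine Lp.ext ?_
  filter_upwards [Lp.coeFn_smul (greenZero g) (cosL2 m), greenOp_ae g, cosL2_ae m,
    ae_restrict_mem measurableSet_Ioo] with x h1 h2 h3 hm
  rw [h1, Pi.smul_apply, h2, h3, smul_eq_mul, greenFun_eq_cos hg (Ioo_subset_Icc_self hm)]

/-- Excludes Jordan chains at `λ_m`. -/
theorem eq_zero_of_eq_smul_greenOp_add {m : ℕ} {g : L2} {b : ℂ}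
    (hg : g = (-freq m ^ 2) • greenOp g + b • cosL2 m) : b = 0 := by
  refine eq_zero_of_resonance (g := g) (freq_ne_zero m) (cos_freq m) ?_
  have h : g =ᵐ[μ₀] ((-freq m ^ 2) • greenOp g + b • cosL2 m : L2) := by rw [← hg]
  filter_upwards [h, Lp.coeFn_add ((-freq m ^ 2) • greenOp g) (b • cosL2 m),
    Lp.coeFn_smul (-freq m ^ 2) (greenOp g), Lp.coeFn_smul b (cosL2 m), greenOp_ae g, cosL2_ae m]
    with x h1 h2 h3 h4 h5 h6
  rw [h1, h2, Pi.add_apply, h3, h4, Pi.smul_apply, Pi.smul_apply, h5, h6, smul_eq_mul, smul_eq_mul]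

theorem exists_inverse_one_sub_smul_greenOp {q : ℂ} (hq : ∀ m, q ≠ -freq m ^ 2) :
    ∃ S : L2 →L[ℂ] L2, ∀ f, S f - q • greenOp (S f) = f ∧ S (f - q • greenOp f) = f := by
  have hc : IsCompactOperator (q • greenOp) := isCompactOperator_greenOp.smul q
  -- For the compact operator `q G`, the number `1` is an eigenvalue or a resolvent point; the
  -- former was just excluded.
  rcases hc.hasEigenvalue_or_mem_resolventSet one_ne_zero with h | h
  · obtain ⟨v, hv⟩ := h.exists_hasEigenvector
    have h1 : q • greenOp v = (1 : ℂ) • v := hv.apply_eq_smul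
    rw [one_smul] at h1
    exact absurd (eq_zero_of_eq_smul_greenOp hq h1.symm) hv.2
  · rw [spectrum.mem_resolventSet_iff, map_one] at h
    obtain ⟨u, hu⟩ := h
    refine ⟨↑u⁻¹, fun f => ⟨?_, ?_⟩⟩
    · have h2 := congrArg (fun T : L2 →L[ℂ] L2 => T f) u.mul_inv
      rw [hu] at h2
      exact h2
    · have h2 := congrArg (fun T : L2 →L[ℂ] L2 => T f) u.inv_mul
      rw [hu] at h2
      exact h2

/-! ### Location and separation of the eigenvalues -/

theorem I_mul_add_ne_of_notMem {c : ℝ} {z : ℂ} (hz : z ∉ range (eigAw c)) (m : ℕ) :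
    Complex.I * (c + z) ≠ -freq m ^ 2 := fun h => by
  rw [← I_mul_add_eigAw c m] at h
  exact hz ⟨m, (add_left_cancel (mul_left_cancel₀ Complex.I_ne_zero h)).symm⟩

theorem eigAw_im (c : ℝ) (m : ℕ) : (eigAw c m).im = ((m : ℝ) + 1 / 2) ^ 2 * Real.pi ^ 2 := by
  have h : eigAw c m =
      ((-c : ℝ) : ℂ) + ((((m : ℝ) + 1 / 2) ^ 2 * Real.pi ^ 2 : ℝ) : ℂ) * Complex.I := by
    rw [eigAw]
    push_cast
    ring
  rw [h]
  simp [-Complex.ofReal_mul]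

theorem one_lt_eigAw_im (c : ℝ) (m : ℕ) : 1 < (eigAw c m).im := by
  rw [eigAw_im]
  have h1 : (1 / 4 : ℝ) ≤ ((m : ℝ) + 1 / 2) ^ 2 := by
    have : (0 : ℝ) ≤ m := m.cast_nonneg
    nlinarith
  have h2 := Real.pi_gt_three
  nlinarith

theorem add_one_lt_eigAw_im (c : ℝ) {m n : ℕ} (h : m < n) :
    (eigAw c m).im + 1 < (eigAw c n).im := by
  rw [eigAw_im, eigAw_im]
  have h0 : (0 : ℝ) ≤ m := m.cast_nonneg
  have h1 : (m : ℝ) + 1 ≤ n := by exact_mod_cast h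
  have h2 : 9 < Real.pi ^ 2 := by nlinarith [Real.pi_gt_three]
  have h3 : ((m : ℝ) + 1 / 2) ^ 2 + 1 ≤ ((n : ℝ) + 1 / 2) ^ 2 := by nlinarith
  nlinarith

theorem neg_notMem_range_eigAw (K c : ℝ) : -(K : ℂ) ∉ range (eigAw c) := by
  rintro ⟨m, hm⟩
  have h := one_lt_eigAw_im c m
  rw [hm, Complex.neg_im, Complex.ofReal_im] at h
  norm_num at h

theorem add_eigAw_ne_zero (K c : ℝ) (m : ℕ) : (K : ℂ) + eigAw c m ≠ 0 := fun h =>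
  neg_notMem_range_eigAw K c ⟨m, (neg_eq_of_add_eq_zero_right h).symm⟩

theorem zero_notMem_range_eigAw (c : ℝ) : (0 : ℂ) ∉ range (eigAw c) := by
  simpa using neg_notMem_range_eigAw 0 c

/-- Imaginary parts alone separate the points: `-K` is real, and the `λ_m` lie above height `1` with
vertical gaps larger than `1`. -/
theorem eq_of_dist_lt_one {K c : ℝ} {y z : ℂ} (hy : y ∈ {-(K : ℂ)} ∪ range (eigAw c))
    (hz : z ∈ {-(K : ℂ)} ∪ range (eigAw c)) (h : dist y z < 1) : y = z := by
  have him := abs_lt.1 ((Complex.abs_im_le_norm (y - z)).trans_lt (dist_eq_norm y z ▸ h))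
  rw [Complex.sub_im] at him
  rcases hy with rfl | ⟨m, rfl⟩ <;> rcases hz with rfl | ⟨n, rfl⟩
  · rfl
  · have := one_lt_eigAw_im c n
    rw [Complex.neg_im, Complex.ofReal_im] at him
    linarith
  · have := one_lt_eigAw_im c m
    rw [Complex.neg_im, Complex.ofReal_im] at him
    linarith
  · rcases lt_trichotomy m n with hmn | rfl | hmn
    · linarith [add_one_lt_eigAw_im c hmn]
    · rfl
    · linarith [add_one_lt_eigAw_im c hmn]

/-! ### Resolvent, eigenvectors and root spaces of `A_w` -/

theorem exists_compact_isBoundedInverse {K c : ℝ} {z : ℂ} (hK : z ≠ -K)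
    (hz : z ∉ range (eigAw c)) :
    ∃ R : StateSpace →L[ℂ] StateSpace,
      IsBoundedInverse (shift (opAw K c) z) R ∧ IsCompactOperator R := by
  have hKz : (K : ℂ) + z ≠ 0 := fun h => hK (neg_eq_of_add_eq_zero_right h).symm
  obtain ⟨S, hS⟩ := exists_inverse_one_sub_smul_greenOp (I_mul_add_ne_of_notMem hz)
  -- The triangular system is solved from below: `U` recovers `g` from the second component, then
  -- `F` recovers `a` from the first after division by `K + z`.
  let U : StateSpace →L[ℂ] L2 := (Complex.I • S).comp (WithLp.sndL 2 ℂ ℂ L2)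
  let F : StateSpace →L[ℂ] ℂ := ((K : ℂ) + z)⁻¹ • (greenZero.comp U - WithLp.fstL 2 ℂ ℂ L2)
  let J : ℂ × L2 →L[ℂ] StateSpace := (WithLp.prodContinuousLinearEquiv 2 ℂ ℂ L2).symm
  let R : StateSpace →L[ℂ] StateSpace :=
    (J.comp (ContinuousLinearMap.inl ℂ ℂ L2)).comp F +
      ((J.comp (ContinuousLinearMap.inr ℂ ℂ L2)).comp greenOp).comp U
  have hR : ∀ Y, R Y = WithLp.toLp 2 (F Y, greenOp (U Y)) := fun Y => by
    have e : R Y = J (F Y, 0) + J (0, greenOp (U Y)) := rfl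
    rw [e, ← map_add, Prod.mk_add_mk, add_zero, zero_add]
    rfl
  refine ⟨R, ⟨fun Y => ?_, ?_⟩, ?_⟩
  · rw [hR]
    refine ⟨toLp_greenOp_mem _ _, ?_⟩
    refine (shift_opAw_apply K c z _ _ _).trans ?_
    have e1 : -(K + z) * F Y + greenZero (U Y) = Y.fst := by
      have e : F Y = ((K : ℂ) + z)⁻¹ * (greenZero (U Y) - Y.fst) := rfl
      rw [e]
      field_simp
      ring
    have e2 : -Complex.I • (U Y - (Complex.I * (c + z)) • greenOp (U Y)) = Y.snd := by
      have e : U Y = Complex.I • S Y.snd := rfl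
      rw [e, map_smul, smul_comm _ Complex.I, ← smul_sub, (hS _).1, smul_smul, neg_mul,
        Complex.I_mul_I, neg_neg, one_smul]
    rw [e1, e2]
    rfl
  · rintro ⟨X, hX⟩
    obtain ⟨a, g, rfl⟩ := exists_eq_greenOp hX
    rw [shift_opAw_apply, hR]
    have e2 : ∀ b, U (WithLp.toLp 2 (b, -Complex.I • (g - (Complex.I * (c + z)) • greenOp g)))
        = g := fun b => by
      change Complex.I • S (-Complex.I • (g - (Complex.I * (c + z)) • greenOp g)) = g
      rw [map_smul, (hS _).2, smul_smul, mul_neg, Complex.I_mul_I, neg_neg, one_smul]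
    have e1 : ∀ b Z, F (WithLp.toLp 2 (b, Z)) =
        ((K : ℂ) + z)⁻¹ * (greenZero (U (WithLp.toLp 2 (b, Z))) - b) := fun _ _ => rfl
    rw [e1, e2]
    congr 2
    field_simp
    ring
  -- One summand factors through `ℂ`, the other through the compact operator `G`.
  · have h1 : IsCompactOperator ((J.comp (ContinuousLinearMap.inl ℂ ℂ L2)).comp F) :=
      (isCompactOperator_of_locallyCompactSpace_rng
        (J.comp (ContinuousLinearMap.inl ℂ ℂ L2))).comp_clm F
    have h2 : IsCompactOperator (((J.comp (ContinuousLinearMap.inr ℂ ℂ L2)).comp greenOp).comp U) :=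
      (isCompactOperator_greenOp.clm_comp (J.comp (ContinuousLinearMap.inr ℂ ℂ L2))).comp_clm U
    exact h1.add h2

/-- The second component of the image is zero, and `z = -K` is not resonant because it is real;
hence `g = 0`. -/
theorem mem_span_of_shift_neg_mem {K c : ℝ} (X : StateSpace)
    (hX : X ∈ (shift (opAw K c) (-(K : ℂ))).domain)
    (h : shift (opAw K c) (-(K : ℂ)) ⟨X, hX⟩ ∈
      Submodule.span ℂ {(WithLp.toLp 2 (1, 0) : StateSpace)}) :
    X ∈ Submodule.span ℂ {(WithLp.toLp 2 (1, 0) : StateSpace)} := by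
  obtain ⟨a, g, rfl⟩ := exists_eq_greenOp hX
  obtain ⟨b, hb⟩ := Submodule.mem_span_singleton.1 h
  rw [shift_opAw_apply, ← WithLp.toLp_smul, Prod.smul_mk, smul_zero] at hb
  have h2 : (0 : L2) = -Complex.I • (g - (Complex.I * (c + -(K : ℂ))) • greenOp g) :=
    congrArg WithLp.snd hb
  have hg : g = 0 := eq_zero_of_eq_smul_greenOp
    (I_mul_add_ne_of_notMem (neg_notMem_range_eigAw K c))
    (sub_eq_zero.1 ((smul_eq_zero.1 h2.symm).resolve_left (neg_ne_zero.2 Complex.I_ne_zero)))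
  refine Submodule.mem_span_singleton.2 ⟨a, ?_⟩
  rw [hg, map_zero, ← WithLp.toLp_smul, Prod.smul_mk, smul_zero, smul_eq_mul, mul_one]

theorem isEigenvector_neg (K c : ℝ) :
    IsEigenvector (opAw K c) (-(K : ℂ)) (WithLp.toLp 2 (1, 0)) := by
  refine isEigenvector_iff_shift.2 ⟨fun h => one_ne_zero (congrArg WithLp.fst h : (1 : ℂ) = 0), ?_⟩
  have h0 : (WithLp.toLp 2 (1, 0) : StateSpace) = WithLp.toLp 2 (1, greenOp 0) := by rw [map_zero]
  rw [h0]
  refine ⟨toLp_greenOp_mem _ _, ?_⟩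
  refine (shift_opAw_apply K c _ _ _ _).trans ?_
  rw [map_zero, map_zero, smul_zero, sub_zero, smul_zero, add_neg_cancel,
    neg_zero, zero_mul, add_zero]
  rfl

/-- The eigenfunction for `λ_m`. -/
def eigVec (K c : ℝ) (m : ℕ) : StateSpace :=
  WithLp.toLp 2 (1 / ((K : ℂ) + eigAw c m), cosL2 m)

/-- If the image is `b` times the eigenvector, the second component is the resonant equation with
forcing `i b`, so `b = 0`. The first component then determines `a` from `w(0)`. -/
theorem mem_span_of_shift_eigAw_mem {K c : ℝ} {m : ℕ} (X : StateSpace)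
    (hX : X ∈ (shift (opAw K c) (eigAw c m)).domain)
    (h : shift (opAw K c) (eigAw c m) ⟨X, hX⟩ ∈ Submodule.span ℂ {eigVec K c m}) :
    X ∈ Submodule.span ℂ {eigVec K c m} := by
  have hK := add_eigAw_ne_zero K c m
  obtain ⟨a, g, rfl⟩ := exists_eq_greenOp hX
  obtain ⟨b, hb⟩ := Submodule.mem_span_singleton.1 h
  rw [shift_opAw_apply, eigVec, ← WithLp.toLp_smul, Prod.smul_mk, I_mul_add_eigAw] at hb
  have h1 : b • (1 / ((K : ℂ) + eigAw c m)) = -(K + eigAw c m) * a + greenZero g :=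
    congrArg WithLp.fst hb
  have h2 : b • cosL2 m = -Complex.I • (g - (-freq m ^ 2) • greenOp g) :=
    congrArg WithLp.snd hb
  have h3 : g = (-freq m ^ 2) • greenOp g + (Complex.I * b) • cosL2 m := by
    rw [mul_smul, h2, smul_smul, mul_neg, Complex.I_mul_I, neg_neg, one_smul, add_sub_cancel]
  have hb0 : b = 0 :=
    (mul_eq_zero.1 (eq_zero_of_eq_smul_greenOp_add h3)).resolve_left Complex.I_ne_zero
  rw [hb0, mul_zero, zero_smul, add_zero] at h3
  rw [hb0, zero_smul] at h1
  refine Submodule.mem_span_singleton.2 ⟨greenZero g, ?_⟩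
  rw [greenOp_eq_smul_cosL2 h3, eigVec, ← WithLp.toLp_smul, Prod.smul_mk]
  congr 2
  rw [smul_eq_mul]
  field_simp
  linear_combination -h1

theorem isEigenvector_eigVec (K c : ℝ) (m : ℕ) :
    IsEigenvector (opAw K c) (eigAw c m) (eigVec K c m) := by
  have hK := add_eigAw_ne_zero K c m
  refine isEigenvector_iff_shift.2 ⟨fun h => cosL2_ne_zero m (congrArg WithLp.snd h), ?_⟩
  -- The cosine is put in the form `G g`, `g` being its second derivative, so that the formula for
  -- `A - z` applies.
  have hg : cosL2 m = greenOp ((-freq m ^ 2) • cosL2 m) := by rw [map_smul, greenOp_cosL2]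
  have h0 : eigVec K c m =
      WithLp.toLp 2 (1 / ((K : ℂ) + eigAw c m), greenOp ((-freq m ^ 2) • cosL2 m)) := by
    rw [← hg, eigVec]
  rw [h0]
  refine ⟨toLp_greenOp_mem _ _, ?_⟩
  refine (shift_opAw_apply K c _ _ _ _).trans ?_
  rw [← valueAt_greenOp_zero, ← hg, I_mul_add_eigAw, sub_self, smul_zero,
    (hasValueAt_cosL2_zero m).valueAt_eq (by simp), neg_mul, mul_one_div_cancel hK, neg_add_cancel]
  rfl

theorem opSpectrum_opAw (K c : ℝ) :
    opSpectrum (opAw K c) = {-(K : ℂ)} ∪ range (eigAw c) := by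
  refine Subset.antisymm (fun z hz => ?_) ?_
  · by_contra h
    rw [mem_union, not_or] at h
    obtain ⟨R, hR, -⟩ := exists_compact_isBoundedInverse (K := K) h.1 h.2
    exact hz ⟨R, hR⟩
  · rintro z (rfl | ⟨m, rfl⟩)
    · exact IsEigenvalue.mem_opSpectrum ⟨_, isEigenvector_neg K c⟩
    · exact IsEigenvalue.mem_opSpectrum ⟨_, isEigenvector_eigVec K c m⟩

end SchrodingerCascade

end

theorem lemma2 (K c : ℝ) (hK : 0 < K) (hc : 0 < c) :
    -- the inverse exists and is compact
    (∃ R : SchrodingerCascade.StateSpace →L[ℂ] SchrodingerCascade.StateSpace,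
      SchrodingerCascade.IsBoundedInverse (SchrodingerCascade.opAw K c) R ∧
      IsCompactOperator R) ∧
    -- the spectrum consists of isolated eigenvalues of finite algebraic multiplicity
    (∀ z ∈ SchrodingerCascade.opSpectrum (SchrodingerCascade.opAw K c),
      SchrodingerCascade.IsIsolatedIn
        (SchrodingerCascade.opSpectrum (SchrodingerCascade.opAw K c)) z ∧
      SchrodingerCascade.IsEigenvalue (SchrodingerCascade.opAw K c) z ∧
      FiniteDimensional ℂ (SchrodingerCascade.rootSpace (SchrodingerCascade.opAw K c) z)) ∧
    -- the spectrum, explicitly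
    SchrodingerCascade.opSpectrum (SchrodingerCascade.opAw K c) =
      {-(K : ℂ)} ∪ Set.range (SchrodingerCascade.eigAw c) ∧
    -- the eigenfunctions for `-K`
    (∀ Y : SchrodingerCascade.StateSpace,
      SchrodingerCascade.IsEigenvector (SchrodingerCascade.opAw K c) (-(K : ℂ)) Y ↔
        ∃ ϑ₀ : ℂ, ϑ₀ ≠ 0 ∧ Y = WithLp.toLp 2 (ϑ₀, 0)) ∧
    -- the eigenfunctions for `λ_m`
    (∀ m : ℕ, (K : ℂ) + SchrodingerCascade.eigAw c m ≠ 0 ∧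
      ∀ Y : SchrodingerCascade.StateSpace,
        SchrodingerCascade.IsEigenvector (SchrodingerCascade.opAw K c)
            (SchrodingerCascade.eigAw c m) Y ↔
          ∃ a : ℂ, a ≠ 0 ∧ Y = a • WithLp.toLp 2
            (1 / ((K : ℂ) + SchrodingerCascade.eigAw c m), SchrodingerCascade.cosL2 m)) := by
  open SchrodingerCascade in
  refine ⟨?_, fun z hz => ⟨⟨hz, 1, one_pos, fun y hy h => ?_⟩, ?_⟩, opSpectrum_opAw K c,
    fun Y => ?_, fun m => ⟨add_eigAw_ne_zero K c m,
      isEigenvector_iff_smul (isEigenvector_eigVec K c m) mem_span_of_shift_eigAw_mem⟩⟩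
  -- Zero is a resolvent point: `K ≠ 0`, and no `λ_m` is real.
  · obtain ⟨R, hR, hc'⟩ := exists_compact_isBoundedInverse (K := K)
      (fun h => hK.ne' (Complex.ofReal_eq_zero.1 (neg_eq_zero.1 h.symm)))
      (zero_notMem_range_eigAw c)
    exact ⟨R, hR.of_shift_zero, hc'⟩
  · rw [opSpectrum_opAw] at hy hz
    exact eq_of_dist_lt_one hy hz h
  · rw [opSpectrum_opAw] at hz
    rcases hz with rfl | ⟨m, rfl⟩
    · exact ⟨⟨_, isEigenvector_neg K c⟩,
        Submodule.finiteDimensional_of_le (rootSpace_le_span mem_span_of_shift_neg_mem)⟩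
    · exact ⟨⟨_, isEigenvector_eigVec K c m⟩,
        Submodule.finiteDimensional_of_le (rootSpace_le_span mem_span_of_shift_eigAw_mem)⟩
  · rw [isEigenvector_iff_smul (isEigenvector_neg K c) mem_span_of_shift_neg_mem]
    simp only [← WithLp.toLp_smul, Prod.smul_mk, smul_zero, smul_eq_mul, mul_one]
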